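/- Let $\alpha>0$ and $\phi(x)=e^{-|x|^\alpha}$ for $x\in\mathbb R$. Write $$A(\mathbb R)=\Big\{x\mapsto\int_{-\infty}^{\infty} g(t)e^{-itx}\,dt \;:\; g\in L_1(\mathbb R)\Big\}$$ for the Wiener algebra of absolutely convergent Fourier integrals. Then: (a) $\phi$ has finite variation in some neighbourhood of $0$, $\phi(0)=1$, $x\phi(x)\in L_1(\mathbb R)$, $\phi\in A(\mathbb R)$, $\phi$ is differentiable at every $x\neq 0$, and the function $x\phi'(x)$ (with the value $0$ at $x=0$) belongs to $A(\mathbb R)\cap L_1(\mathbb R)$. (b) Let $f$ be a $2\pi$-periodic complex-valued function on $\mathbb R$, integrable on $[-\pi,\pi]$, with Fourier coefficients $\widehat f_k=\frac1{2\pi}\int_{-\pi}^{\pi}f(t)e^{-ikt}\,dt$, and let $x\in\mathbb R$ be a $d$-point of $f$, that is, a point at which $F(y)=\int_0^y f(t)\,dt$ has a finite derivative $d_f(x)=F'(x)$. Then the series below converge absolutely for every $n\ge 0$ and every $\varepsilon>0$, and $$\lim_{n\to\infty}\sum_{k=-\infty}^{\infty}\phi\Big(\frac{k}{n+1}\Big)\widehat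 f_k e^{ikx}=d_f(x),\qquad \lim_{\varepsilon\to 0+}\sum_{k=-\infty}^{\infty}\phi(\varepsilon k)\widehat f_k e^{ikx}=d_f(x).$$ -/

import Mathlib

open Real Complex MeasureTheory Filter Topology

/-- The Wiener algebra `A(ℝ)` of absolutely convergent Fourier integrals: the functions
`f(x) = ∫ g(t) e^{-itx} dt` (for every `x`) with `g ∈ L₁(ℝ)`. -/
def MemWienerAlgebra (f : ℝ → ℂ) : Prop :=
  ∃ g : ℝ → ℂ, Integrable g ∧
    ∀ x : ℝ, f x = ∫ t : ℝ, g t * Complex.exp (-(Complex.I * (t : ℂ) * (x : ℂ)))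

/-- The conditions on a multiplier function `φ`: it has finite variation in a neighbourhood of `0`,
`φ(0) = 1`, `x φ(x) ∈ L₁(ℝ)`, `φ ∈ A(ℝ)`, and `x φ'(x) ∈ A(ℝ) ∩ L₁(ℝ)`.

The derivative is required to exist at every `x ≠ 0`; at `x = 0`, where `φ'` need not exist,
the function `x φ'(x)` has the value `0`. -/
structure IsDPointMultiplier (φ : ℝ → ℂ) : Prop where
  locally_bv : ∃ δ : ℝ, 0 < δ ∧ BoundedVariationOn φ (Set.Ioo (-δ) δ)
  map_zero : φ 0 = 1
  integrable_mul : Integrable (fun x : ℝ => (x : ℂ) * φ x)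
  mem_wiener : MemWienerAlgebra φ
  differentiableAt : ∀ x : ℝ, x ≠ 0 → DifferentiableAt ℝ φ x
  mem_wiener_mul_deriv : MemWienerAlgebra (fun x : ℝ => (x : ℂ) * deriv φ x)
  integrable_mul_deriv : Integrable (fun x : ℝ => (x : ℂ) * deriv φ x)

/-- `x` is a `d`-point of `f` with value `d = d_f(x)`: the function `F(y) = ∫₀^y f(t) dt`
is differentiable at `x` with derivative `d`. -/
def IsDPoint (f : ℝ → ℂ) (x : ℝ) (d : ℂ) : Prop :=
  HasDerivAt (fun y : ℝ => ∫ t in (0 : ℝ)..y, f t) d x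

/-- The `k`-th term `c k * f̂_k * e^{ikx}` of the Fourier series of the `2π`-periodic function `f`
with multipliers `c`, where `f̂_k = (1/2π) ∫_{-π}^{π} f(t) e^{-ikt} dt`. -/
noncomputable def multiplierTerm (c : ℤ → ℂ) (f : ℝ → ℂ) (x : ℝ) (k : ℤ) : ℂ :=
  c k * fourierCoeffOn (neg_lt_self Real.pi_pos) f k *
    Complex.exp (Complex.I * (k : ℂ) * (x : ℂ))

/-! Write h_{b,c}(x) = (b + c|x|^α) e^{-|x|^α}. This family contains every function needed: φ =
h_{1,0}, xφ' = h_{0,-α} and (xφ)' = h_{1,-α}. Each member has an integrable Fourier transform, by a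
Bernstein-type criterion: its second differences with step w have L¹ norm O(w^{1+a}) for some 0 < a
< 1, so the transform is O(|t|^{-1-a}) at infinity (`integrable_fourier_of_second_difference`,
`integrable_fourier_stretchedExp`). Fourier inversion then puts φ and xφ' in the Wiener algebra; the
rest of (a) is decay and monotonicity.

For (b), let m be the transform of xφ(x). Then 2πi t m(t) is the transform of (xφ)', hence
integrable, and by inversion at 0 its integral is (xφ)'(0) = 1. Translate the d-point to 0, subtract
the mean c of f, and let G be the periodic primitive of f(x + ·) - c vanishing at 0. The
coefficients of f(x + ·) - c are ik Ĝ_k, so the extra factor k turns the multiplier φ(εk) into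
εkφ(εk), and the sum becomes c + ∫ 2πi t m(t) · G(2πεt)/(2πεt) dt. The quotient is bounded and tends
to G'(0) = d - c, so dominated convergence gives the limit c + (d - c) = d
(`tendsto_tsum_multiplierTerm`). Only differentiability of the primitive at one point is used. -/

open scoped FourierTransform

/-! ### Decay of the family h_{b,c} -/

/-- The function `(b + c |x|^α) e^{-|x|^α}`. -/
noncomputable def stretchedExp (α b c x : ℝ) : ℝ := (b + c * |x| ^ α) * Real.exp (-(|x| ^ α))

/-- Powers of `|x|` times `e^{-|x|^α}` decay like any power of `1 + |x|`. -/
theorem exists_rpow_mul_exp_neg_abs_rpow_le {α : ℝ} (hα : 0 < α) {s : ℝ} (hs : 0 ≤ s) :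
    ∃ C : ℝ, 0 < C ∧ ∀ x : ℝ, |x| ^ s * Real.exp (-(|x| ^ α)) ≤ C * (1 + |x|) ^ (-2 : ℝ) := by
  -- With αN ≥ s + 2, the bound e^u ≥ u^N/N! at u = y^α absorbs y^{s+2} when y ≥ 1. The factor 4
  -- comes from (1 + y)² ≤ 4 max(1, y)².
  obtain ⟨N, hN⟩ := exists_nat_ge ((s + 2) / α)
  have hN' : s + 2 ≤ α * N := by rwa [div_le_iff₀' hα] at hN
  refine ⟨4 * (N.factorial : ℝ), by positivity, fun x => ?_⟩
  obtain ⟨y, hy, hy0⟩ : ∃ y, y = |x| ∧ 0 ≤ y := ⟨_, rfl, abs_nonneg x⟩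
  rw [← hy]
  have hfac : (1 : ℝ) ≤ N.factorial := by exact_mod_cast Nat.one_le_iff_ne_zero.2 N.factorial_ne_zero
  rw [Real.rpow_neg (by positivity), ← div_eq_mul_inv, le_div_iff₀ (by positivity), Real.rpow_two]
  rcases le_total y 1 with h1 | h1
  · have e1 : y ^ s ≤ 1 := Real.rpow_le_one hy0 h1 hs
    have e2 : Real.exp (-(y ^ α)) ≤ 1 := by
      rw [Real.exp_le_one_iff]; have := Real.rpow_nonneg hy0 α; linarith
    calc y ^ s * Real.exp (-(y ^ α)) * (1 + y) ^ 2 ≤ 1 * 1 * (1 + 1) ^ 2 := by gcongr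
      _ ≤ 4 * (N.factorial : ℝ) := by linarith
  · have hy1 : 0 < y := by linarith
    have e1 := Real.pow_div_factorial_le_exp (x := y ^ α) (by positivity) N
    rw [← Real.rpow_natCast, ← Real.rpow_mul hy0, div_le_iff₀ (by positivity)] at e1
    have e2 : y ^ (s + 2) ≤ Real.exp (y ^ α) * N.factorial :=
      (Real.rpow_le_rpow_of_exponent_le h1 hN').trans e1
    rw [Real.rpow_add hy1, Real.rpow_two] at e2
    have e3 : y ^ s * y ^ 2 * Real.exp (-(y ^ α)) ≤ N.factorial := by
      rw [Real.exp_neg, ← div_eq_mul_inv, div_le_iff₀ (Real.exp_pos _)]; linarith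
    calc y ^ s * Real.exp (-(y ^ α)) * (1 + y) ^ 2
        ≤ y ^ s * Real.exp (-(y ^ α)) * (y + y) ^ 2 := by gcongr
      _ = 4 * (y ^ s * y ^ 2 * Real.exp (-(y ^ α))) := by ring
      _ ≤ _ := by gcongr

theorem integrable_one_add_abs_rpow {r : ℝ} (hr : r < -1) :
    Integrable (fun x : ℝ => (1 + |x|) ^ r) := by
  have := integrable_one_add_norm (E := ℝ) (μ := volume) (r := -r) (by simp; linarith)
  simpa using this

theorem continuous_stretchedExp {α : ℝ} (hα : 0 < α) (b c : ℝ) :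
    Continuous (stretchedExp α b c) := by
  have : Continuous fun x : ℝ => |x| ^ α :=
    continuous_abs.rpow_const fun _ => Or.inr hα.le
  unfold stretchedExp
  fun_prop

theorem exists_abs_stretchedExp_le {α : ℝ} (hα : 0 < α) (b c : ℝ) :
    ∃ C : ℝ, 0 < C ∧ ∀ x : ℝ, |stretchedExp α b c x| ≤ C * (1 + |x|) ^ (-2 : ℝ) := by
  obtain ⟨C₀, h₀, H₀⟩ := exists_rpow_mul_exp_neg_abs_rpow_le hα le_rfl
  obtain ⟨C₁, h₁, H₁⟩ := exists_rpow_mul_exp_neg_abs_rpow_le hα hα.le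
  refine ⟨|b| * C₀ + |c| * C₁ + 1, by positivity, fun x => ?_⟩
  have e₀ := H₀ x
  have e₁ := H₁ x
  rw [Real.rpow_zero, one_mul] at e₀
  have hp : 0 ≤ (1 + |x|) ^ (-2 : ℝ) := by positivity
  have hq : 0 ≤ |x| ^ α := by positivity
  calc |stretchedExp α b c x| = |b + c * |x| ^ α| * Real.exp (-(|x| ^ α)) := by
        rw [stretchedExp, abs_mul, Real.abs_exp]
    _ ≤ (|b| + |c| * |x| ^ α) * Real.exp (-(|x| ^ α)) := by
        gcongr
        refine (abs_add_le _ _).trans ?_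
        rw [abs_mul, abs_of_nonneg hq]
    _ = |b| * Real.exp (-(|x| ^ α)) + |c| * (|x| ^ α * Real.exp (-(|x| ^ α))) := by ring
    _ ≤ |b| * (C₀ * (1 + |x|) ^ (-2 : ℝ)) + |c| * (C₁ * (1 + |x|) ^ (-2 : ℝ)) := by gcongr
    _ ≤ _ := by nlinarith

theorem integrable_stretchedExp {α : ℝ} (hα : 0 < α) (b c : ℝ) :
    Integrable (fun x : ℝ => ((stretchedExp α b c x : ℝ) : ℂ)) := by
  obtain ⟨C, -, H⟩ := exists_abs_stretchedExp_le hα b c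
  refine ((integrable_one_add_abs_rpow (r := -2) (by norm_num)).const_mul C).mono'
    ((Complex.continuous_ofReal.comp (continuous_stretchedExp hα b c)).aestronglyMeasurable)
    (ae_of_all _ fun x => ?_)
  rw [Complex.norm_real]
  exact H x

theorem exists_abs_mul_exp_neg_abs_rpow_le {α : ℝ} (hα : 0 < α) :
    ∃ C : ℝ, 0 < C ∧ ∀ x : ℝ, |x * Real.exp (-(|x| ^ α))| ≤ C * (1 + |x|) ^ (-2 : ℝ) := by
  obtain ⟨C, h, H⟩ := exists_rpow_mul_exp_neg_abs_rpow_le hα zero_le_one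
  refine ⟨C, h, fun x => ?_⟩
  rw [abs_mul, Real.abs_exp]
  simpa using H x

/-! ### Derivatives and second differences of h_{b,c} -/

/-- The derivative of `stretchedExp α b c` on the positive half-line. -/
noncomputable def stretchedExpDeriv (α b c x : ℝ) : ℝ :=
  x⁻¹ * (α * ((c - b) * x ^ α - c * (x ^ α) ^ 2) * Real.exp (-(x ^ α)))

/-- The second derivative of `stretchedExp α b c` on the positive half-line. -/
noncomputable def stretchedExpDeriv₂ (α b c x : ℝ) : ℝ :=
  (x ^ 2)⁻¹ * (α * x ^ α * ((α - 1) * (c - b) + (c - 2 * α * c - α * (c - b)) * x ^ α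
    + α * c * (x ^ α) ^ 2) * Real.exp (-(x ^ α)))

theorem hasDerivAt_stretchedExp (α b c : ℝ) {x : ℝ} (hx : 0 < x) :
    HasDerivAt (stretchedExp α b c) (stretchedExpDeriv α b c x) x := by
  have h1 : HasDerivAt (fun y : ℝ => y ^ α) (α * x ^ (α - 1)) x :=
    Real.hasDerivAt_rpow_const (Or.inl hx.ne')
  have h2 := ((h1.const_mul c).const_add b).mul h1.fun_neg.exp
  refine (h2.congr_of_eventuallyEq ?_).congr_deriv ?_
  · filter_upwards [lt_mem_nhds hx] with y hy
    simp [stretchedExp, abs_of_pos hy]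
  · rw [Real.rpow_sub hx, Real.rpow_one, stretchedExpDeriv]
    field_simp
    ring

theorem hasDerivAt_stretchedExpDeriv (α b c : ℝ) {x : ℝ} (hx : 0 < x) :
    HasDerivAt (stretchedExpDeriv α b c) (stretchedExpDeriv₂ α b c x) x := by
  have h1 : HasDerivAt (fun y : ℝ => y ^ α) (α * x ^ (α - 1)) x :=
    Real.hasDerivAt_rpow_const (Or.inl hx.ne')
  have h2 := (hasDerivAt_inv hx.ne').fun_mul
    ((((h1.const_mul (c - b)).fun_sub ((h1.fun_pow 2).const_mul c)).const_mul α).fun_mul h1.fun_neg.exp)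
  refine h2.congr_deriv ?_
  rw [Real.rpow_sub hx, Real.rpow_one, stretchedExpDeriv₂]
  field_simp
  ring

theorem pow_mul_exp_neg_le_factorial {u : ℝ} (hu : 0 ≤ u) (n : ℕ) :
    u ^ n * Real.exp (-u) ≤ n.factorial := by
  have := Real.pow_div_factorial_le_exp u hu n
  rw [div_le_iff₀ (by positivity)] at this
  rw [Real.exp_neg, ← div_eq_mul_inv, div_le_iff₀ (Real.exp_pos _)]
  linarith

/-- With u = x^α the second derivative is x^{-2} times u·(polynomial in u)·e^{-u}, so it is of order
x^{α-2} at 0 and is damped by the exponential at infinity. The freedom to lower α to a is what later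
allows a < 1. -/
theorem exists_abs_stretchedExpDeriv₂_le {α a : ℝ} (hα : 0 < α) (ha : 0 < a) (haα : a ≤ α)
    (b c : ℝ) :
    ∃ C : ℝ, 0 < C ∧ ∀ x : ℝ, 0 < x → |stretchedExpDeriv₂ α b c x| ≤ C * x ^ (a - 2) := by
  set K₀ := |(α - 1) * (c - b)|
  set K₁ := |c - 2 * α * c - α * (c - b)|
  set K₂ := |α * c|
  refine ⟨α * ((K₀ + K₁ + K₂) * 9) + 1, by positivity, fun x hx => ?_⟩
  obtain ⟨u, hu⟩ : ∃ u, u = x ^ α := ⟨_, rfl⟩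
  have hu0 : 0 ≤ u := hu ▸ by positivity
  have hxa : 0 < x ^ a := by positivity
  -- The constant is 9 = 1! + 2! + 3!, from u^n e^{-u} ≤ n! when x ≥ 1; for x ≤ 1 even 3 would do.
  have key : (u + u ^ 2 + u ^ 3) * Real.exp (-u) ≤ 9 * x ^ a := by
    rcases le_total x 1 with h | h
    · have h1 : u ≤ x ^ a := hu ▸ Real.rpow_le_rpow_of_exponent_ge hx h haα
      have h2 : u ≤ 1 := hu ▸ Real.rpow_le_one hx.le h hα.le
      have h3 : Real.exp (-u) ≤ 1 := by rw [Real.exp_le_one_iff]; linarith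
      calc (u + u ^ 2 + u ^ 3) * Real.exp (-u) ≤ (u + u ^ 2 + u ^ 3) * 1 := by gcongr
        _ ≤ 9 * u := by nlinarith [mul_nonneg hu0 hu0, mul_nonneg hu0 (mul_nonneg hu0 hu0)]
        _ ≤ 9 * x ^ a := by gcongr
    · have h1 : 1 ≤ x ^ a := Real.one_le_rpow h ha.le
      have e1 := pow_mul_exp_neg_le_factorial hu0 1
      have e2 := pow_mul_exp_neg_le_factorial hu0 2
      have e3 := pow_mul_exp_neg_le_factorial hu0 3
      norm_num [Nat.factorial] at e1 e2 e3
      linarith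
  have hpoly : |(α - 1) * (c - b) + (c - 2 * α * c - α * (c - b)) * u + α * c * u ^ 2|
      ≤ (K₀ + K₁ + K₂) * (1 + u + u ^ 2) := by
    refine (abs_add_three _ _ _).trans ?_
    rw [abs_mul _ u, abs_mul _ (u ^ 2), abs_of_nonneg hu0, abs_of_nonneg (sq_nonneg u)]
    have hK0 : 0 ≤ K₀ := abs_nonneg _
    have hK1 : 0 ≤ K₁ := abs_nonneg _
    have hK2 : 0 ≤ K₂ := abs_nonneg _
    change K₀ + K₁ * u + K₂ * u ^ 2 ≤ _
    nlinarith [mul_nonneg hK0 hu0, mul_nonneg hK1 hu0, mul_nonneg hK2 hu0,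
      mul_nonneg hK0 (sq_nonneg u), mul_nonneg hK1 (sq_nonneg u), mul_nonneg hK2 (sq_nonneg u)]
  rw [stretchedExpDeriv₂, ← hu, abs_mul, abs_mul, abs_mul, abs_mul, abs_of_pos hα,
    abs_of_nonneg hu0, Real.abs_exp, abs_of_nonneg (by positivity : 0 ≤ (x ^ 2)⁻¹),
    Real.rpow_sub hx, Real.rpow_two]
  calc (x ^ 2)⁻¹ * (α * u * _ * Real.exp (-u))
      ≤ (x ^ 2)⁻¹ * (α * u * ((K₀ + K₁ + K₂) * (1 + u + u ^ 2)) * Real.exp (-u)) := by gcongr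
    _ = (x ^ 2)⁻¹ * (α * ((K₀ + K₁ + K₂) * ((u + u ^ 2 + u ^ 3) * Real.exp (-u)))) := by ring
    _ ≤ (x ^ 2)⁻¹ * (α * ((K₀ + K₁ + K₂) * (9 * x ^ a))) := by gcongr
    _ = α * ((K₀ + K₁ + K₂) * 9) * (x ^ a / x ^ 2) := by ring
    _ ≤ _ := by
      gcongr
      linarith

/-- A Hölder estimate at 0, standing in for the bound on the second derivative, which may blow up
there. It follows from 1 - e^{-u} ≤ min(1, u) and u e^{-u} ≤ min(1, u). -/
theorem abs_stretchedExp_sub_le {α a : ℝ} (hα : 0 < α) (ha : 0 < a) (haα : a ≤ α) (b c x : ℝ) :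
    |stretchedExp α b c x - b| ≤ (2 * |b| + |c|) * |x| ^ a := by
  obtain ⟨y, hy, hy0⟩ : ∃ y, y = |x| ∧ 0 ≤ y := ⟨_, rfl, abs_nonneg x⟩
  obtain ⟨u, hu⟩ : ∃ u, u = y ^ α := ⟨_, rfl⟩
  have hu0 : 0 ≤ u := hu ▸ by positivity
  rw [stretchedExp, ← hy, ← hu]
  have hE0 := Real.exp_pos (-u)
  have hE1 : Real.exp (-u) ≤ 1 := by rw [Real.exp_le_one_iff]; linarith
  have hE2 : 1 - Real.exp (-u) ≤ u := by linarith [Real.add_one_le_exp (-u)]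
  have hE3 := pow_mul_exp_neg_le_factorial hu0 1
  norm_num at hE3
  have e : |(b + c * u) * Real.exp (-u) - b| ≤
      |b| * (1 - Real.exp (-u)) + |c| * (u * Real.exp (-u)) := by
    rw [show (b + c * u) * Real.exp (-u) - b
      = -(b * (1 - Real.exp (-u))) + c * (u * Real.exp (-u)) by ring]
    refine (abs_add_le _ _).trans ?_
    rw [abs_neg, abs_mul, abs_mul, abs_of_nonneg (by linarith : 0 ≤ 1 - Real.exp (-u)),
      abs_of_nonneg (by positivity : 0 ≤ u * Real.exp (-u))]
  refine e.trans ?_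
  rcases le_total y 1 with h | h
  · have h1 : u ≤ y ^ a := by
      rcases hy0.eq_or_lt with h0 | h0
      · rw [hu, ← h0, Real.zero_rpow hα.ne', Real.zero_rpow ha.ne']
      · exact hu ▸ Real.rpow_le_rpow_of_exponent_ge h0 h haα
    calc |b| * (1 - Real.exp (-u)) + |c| * (u * Real.exp (-u))
        ≤ |b| * u + |c| * (u * 1) := by gcongr
      _ ≤ (2 * |b| + |c|) * u := by nlinarith [abs_nonneg b, mul_nonneg (abs_nonneg b) hu0]
      _ ≤ _ := by gcongr
  · have h1 : 1 ≤ y ^ a := Real.one_le_rpow h ha.le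
    calc |b| * (1 - Real.exp (-u)) + |c| * (u * Real.exp (-u))
        ≤ |b| * 1 + |c| * 1 := by gcongr; linarith
      _ ≤ (2 * |b| + |c|) * 1 := by linarith [abs_nonneg b]
      _ ≤ _ := by gcongr

theorem stretchedExp_neg (α b c x : ℝ) : stretchedExp α b c (-x) = stretchedExp α b c x := by
  simp [stretchedExp]

/-- A second difference is controlled by a bound on the second derivative. -/
theorem abs_second_difference_le {f f' f'' : ℝ → ℝ} {x w M : ℝ} (hw : 0 ≤ w)
    (hf : ∀ y ∈ Set.Icc (x - w) (x + w), HasDerivAt f (f' y) y)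
    (hf' : ∀ y ∈ Set.Icc (x - w) (x + w), HasDerivAt f' (f'' y) y)
    (hM : ∀ y ∈ Set.Icc (x - w) (x + w), |f'' y| ≤ M) :
    |f (x + w) - 2 * f x + f (x - w)| ≤ M * w * w := by
  -- The mean value inequality is used twice: for f' over a step w, then for y ↦ f(y + w) - f(y) on
  -- [x - w, x].
  have h1 : ∀ y ∈ Set.Icc (x - w) x, |f' (y + w) - f' y| ≤ M * w := by
    intro y hy
    have := (convex_Icc (x - w) (x + w)).norm_image_sub_le_of_norm_hasDerivWithin_le
      (fun z hz => (hf' z hz).hasDerivWithinAt) hM (x := y) (y := y + w)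
      ⟨hy.1, by linarith [hy.2]⟩ ⟨by linarith [hy.1], by linarith [hy.2]⟩
    simpa [abs_of_nonneg hw] using this
  have h2 := (convex_Icc (x - w) x).norm_image_sub_le_of_norm_hasDerivWithin_le
    (f := fun y => f (y + w) - f y) (f' := fun y => f' (y + w) - f' y) (C := M * w)
    (fun z hz => (((hf (z + w) ⟨by linarith [hz.1], by linarith [hz.2]⟩).comp_add_const z w).sub
      (hf z ⟨hz.1, by linarith [hz.2]⟩)).hasDerivWithinAt) h1 (x := x - w) (y := x)
      ⟨le_rfl, by linarith⟩ ⟨by linarith, le_rfl⟩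
  simp only [Real.norm_eq_abs, sub_add_cancel, sub_sub_cancel, abs_of_nonneg hw] at h2
  rwa [show f (x + w) - 2 * f x + f (x - w) = f (x + w) - f x - (f x - f (x - w)) by ring]

/-- For |x| ≤ 2w the Hölder estimate at 0 applies to all three points; for |x| ≥ 2w they stay at
distance at least |x|/2 from 0 and the second derivative bound applies. The scaled form of the
majorant makes its integral a constant times w^{1+a} when a < 1. -/
theorem exists_abs_second_difference_stretchedExp_le {α a : ℝ} (hα : 0 < α) (ha : 0 < a)
    (haα : a ≤ α) (ha1 : a ≤ 1) (b c : ℝ) :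
    ∃ C : ℝ, 0 < C ∧ ∀ w : ℝ, 0 < w → ∀ x : ℝ,
      |stretchedExp α b c (x + w) - 2 * stretchedExp α b c x + stretchedExp α b c (x - w)|
        ≤ C * (w ^ a * (1 + |x / w|) ^ (a - 2)) := by
  obtain ⟨D, hD, H⟩ := exists_abs_stretchedExpDeriv₂_le hα ha haα b c
  set A := 2 * |b| + |c| with hA
  have hA0 : 0 ≤ A := by positivity
  refine ⟨108 * A + 9 * D, by positivity, fun w hw => ?_⟩
  set h := stretchedExp α b c with hh
  have key : ∀ x : ℝ, 0 ≤ x → |h (x + w) - 2 * h x + h (x - w)|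
      ≤ (108 * A + 9 * D) * (w ^ a * (1 + |x / w|) ^ (a - 2)) := by
    intro x hx
    rw [abs_of_nonneg (by positivity : 0 ≤ x / w)]
    have hP : 0 < (1 + x / w) ^ (a - 2) := by positivity
    have hwa : 0 < w ^ a := by positivity
    -- The base 3 serves both ranges: 1 + x/w ≤ 3 if x ≤ 2w, and x/2 ≥ (w + x)/3 if x ≥ 2w.
    have h9 : (3 : ℝ) ^ (2 - a) ≤ 9 := by
      have := Real.rpow_le_rpow_of_exponent_le (x := (3 : ℝ)) (by norm_num) (by linarith : 2 - a ≤ 2)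
      norm_num at this ⊢
      exact this
    have h3inv : (3 : ℝ) ^ (2 - a) * 3 ^ (a - 2) = 1 := by
      rw [← Real.rpow_add (by norm_num)]; norm_num
    rcases le_total x (2 * w) with hxw | hxw
    -- The value b cancels in the second difference, whose weights 1, 2, 1 then give 4 · 3A = 12A.
    · have hb : ∀ y : ℝ, |y| ≤ 3 * w → |h y - b| ≤ A * (3 * w ^ a) := by
        intro y hy
        refine (abs_stretchedExp_sub_le hα ha haα b c y).trans ?_
        have h3 : (3 : ℝ) ^ a ≤ 3 := by
          have := Real.rpow_le_rpow_of_exponent_le (x := (3 : ℝ)) (by norm_num) ha1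
          rwa [Real.rpow_one] at this
        calc A * |y| ^ a ≤ A * (3 * w) ^ a := by gcongr
          _ = A * (3 ^ a * w ^ a) := by rw [Real.mul_rpow (by norm_num) hw.le]
          _ ≤ _ := by gcongr
      have e1 := hb (x + w) (by rw [abs_of_nonneg (by linarith)]; linarith)
      have e2 := hb x (by rw [abs_of_nonneg hx]; linarith)
      have e3 := hb (x - w) (by rw [abs_le]; constructor <;> linarith)
      have e4 : |h (x + w) - 2 * h x + h (x - w)| ≤ 12 * A * w ^ a := by
        rw [abs_le] at *
        constructor <;> linarith [e1.1, e1.2, e2.1, e2.2, e3.1, e3.2]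
      have hP3 : (3 : ℝ) ^ (a - 2) ≤ (1 + x / w) ^ (a - 2) := by
        apply Real.rpow_le_rpow_of_nonpos (by positivity) _ (by linarith)
        have : x / w ≤ 2 := by rwa [div_le_iff₀ hw]
        linarith
      have h19 : 1 ≤ 9 * (1 + x / w) ^ (a - 2) := by
        exact h3inv.symm.le.trans (mul_le_mul h9 hP3 (by positivity) (by norm_num))
      calc _ ≤ 12 * A * w ^ a * 1 := by linarith
        _ ≤ 12 * A * w ^ a * (9 * (1 + x / w) ^ (a - 2)) := by gcongr
        _ = 108 * A * (w ^ a * (1 + x / w) ^ (a - 2)) := by ring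
        _ ≤ _ := by gcongr; linarith
    · have hx0 : 0 < x := by linarith
      have e := abs_second_difference_le (f := h) (x := x) (w := w) (M := D * (x / 2) ^ (a - 2)) hw.le
        (fun y hy => hasDerivAt_stretchedExp α b c (by linarith [hy.1]))
        (fun y hy => hasDerivAt_stretchedExpDeriv α b c (by linarith [hy.1]))
        (fun y hy => (H y (by linarith [hy.1])).trans (mul_le_mul_of_nonneg_left
          (Real.rpow_le_rpow_of_nonpos (by linarith) (by linarith [hy.1]) (by linarith)) hD.le))
      have e5 : (x / 2) ^ (a - 2) ≤ 9 * (w ^ (a - 2) * (1 + x / w) ^ (a - 2)) := by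
        calc (x / 2) ^ (a - 2) ≤ (3⁻¹ * (w * (1 + x / w))) ^ (a - 2) := by
              apply Real.rpow_le_rpow_of_nonpos (by positivity) _ (by linarith)
              rw [mul_add, mul_div_cancel₀ _ hw.ne']
              linarith
          _ = 3 ^ (2 - a) * (w ^ (a - 2) * (1 + x / w) ^ (a - 2)) := by
              rw [Real.mul_rpow (by norm_num) (by positivity), Real.mul_rpow hw.le (by positivity),
                Real.inv_rpow (by norm_num), ← Real.rpow_neg (by norm_num), neg_sub]
          _ ≤ _ := by gcongr
      have e6 : w ^ (a - 2) * w * w = w ^ a := by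
        rw [Real.rpow_sub hw, Real.rpow_two]; field_simp
      calc _ ≤ D * (x / 2) ^ (a - 2) * w * w := e
        _ ≤ D * (9 * (w ^ (a - 2) * (1 + x / w) ^ (a - 2))) * w * w := by gcongr
        _ = 9 * D * (w ^ (a - 2) * w * w * (1 + x / w) ^ (a - 2)) := by ring
        _ = 9 * D * (w ^ a * (1 + x / w) ^ (a - 2)) := by rw [e6]
        _ ≤ _ := by gcongr; linarith
  intro x
  rcases le_total 0 x with hx | hx
  · exact key x hx
  · have := key (-x) (by linarith)
    rw [neg_div, abs_neg, hh, stretchedExp_neg, show -x + w = -(x - w) by ring,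
      show -x - w = -(x + w) by ring, stretchedExp_neg, stretchedExp_neg] at this
    rwa [show h (x + w) - 2 * h x + h (x - w) = h (x - w) - 2 * h x + h (x + w) by ring]

/-! ### Bernstein's criterion and integrability of the transforms -/

theorem norm_fourier_le_integral_norm (f : ℝ → ℂ) (t : ℝ) : ‖𝓕 f t‖ ≤ ∫ x, ‖f x‖ :=
  VectorFourier.norm_fourierIntegral_le_integral_norm _ _ _ _ _

theorem continuous_fourier_of_integrable {f : ℝ → ℂ} (hf : Integrable f) : Continuous (𝓕 f) :=
  VectorFourier.fourierIntegral_continuous Real.continuous_fourierChar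
    (by exact continuous_inner) hf

theorem fourier_comp_add_right (f : ℝ → ℂ) (w t : ℝ) :
    𝓕 (fun x => f (x + w)) t = Complex.exp (2 * π * I * (w * t)) * 𝓕 f t := by
  rw [Real.fourier_real_eq_integral_exp_smul, Real.fourier_real_eq_integral_exp_smul,
    ← integral_const_mul, ← integral_add_right_eq_self
      (fun x => Complex.exp (2 * π * I * (w * t)) * _) w]
  refine integral_congr_ae (ae_of_all _ fun x => ?_)
  simp only [smul_eq_mul]
  rw [← mul_assoc, ← Complex.exp_add]
  congr 2
  push_cast
  ring

/-- The step 1/(2|t|) is half a period of the frequency t: translation by it in either direction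
multiplies the transform at t by -1, so the second difference multiplies it by -4. -/
theorem four_mul_norm_fourier_le {f : ℝ → ℂ} (hf : Integrable f) {t : ℝ} (ht : t ≠ 0) :
    4 * ‖𝓕 f t‖ ≤ ∫ x, ‖f (x + (2 * |t|)⁻¹) - 2 * f x + f (x - (2 * |t|)⁻¹)‖ := by
  set w := (2 * |t|)⁻¹ with hw
  have hexp : ∀ s : ℝ, |s| = w → Complex.exp (2 * π * I * (s * t)) = -1 := by
    intro s hs
    have h1 : |s * t| = 1 / 2 := by
      rw [abs_mul, hs, hw]; field_simp
    have h2 : s * t = 1 / 2 ∨ s * t = -(1 / 2) := eq_or_eq_neg_of_abs_eq h1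
    rw [← Complex.ofReal_mul]
    rcases h2 with h | h <;> rw [h] <;> push_cast
    · rw [show 2 * (π : ℂ) * I * (1 / 2) = π * I by ring, Complex.exp_pi_mul_I]
    · rw [show 2 * (π : ℂ) * I * (-(1 / 2)) = -(π * I) by ring, Complex.exp_neg,
        Complex.exp_pi_mul_I]
      norm_num
  have hw0 : 0 < w := by positivity
  have h1 := fourier_comp_add_right f w t
  have h2 := fourier_comp_add_right f (-w) t
  rw [hexp w (abs_of_pos hw0)] at h1
  rw [hexp (-w) (by rw [abs_neg, abs_of_pos hw0])] at h2
  have key : 𝓕 (fun x => f (x + w) - 2 * f x + f (x - w)) t = -4 * 𝓕 f t := by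
    have e : (fun x => f (x + w) - 2 * f x + f (x - w))
        = (fun x => f (x + w)) + ((-2 : ℂ) • f + fun x => f (x + -w)) := by
      funext x; simp [sub_eq_add_neg]; ring
    have hl : ∀ {g k : ℝ → ℂ}, Integrable g → Integrable k → 𝓕 (g + k) t = 𝓕 g t + 𝓕 k t := by
      intro g k hg hk
      exact (congrFun (VectorFourier.fourierIntegral_add Real.continuous_fourierChar
        (by exact continuous_inner) hg hk) t)
    have hs : 𝓕 ((-2 : ℂ) • f) t = -2 * 𝓕 f t :=
      congrFun (VectorFourier.fourierIntegral_const_smul _ _ _ f (-2 : ℂ)) t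
    rw [e, hl (hf.comp_add_right w) ((hf.smul _).add (hf.comp_add_right (-w))),
      hl (hf.smul _) (hf.comp_add_right (-w)), h1, h2, hs]
    ring
  have := norm_fourier_le_integral_norm (fun x => f (x + w) - 2 * f x + f (x - w)) t
  rw [key] at this
  simpa using this

/-- Bernstein's criterion with second differences in `L¹`. -/
theorem integrable_fourier_of_second_difference {f : ℝ → ℂ} (hf : Integrable f) {a C : ℝ}
    (ha : 0 < a) (h : ∀ w : ℝ, 0 < w →
      ∫ x, ‖f (x + w) - 2 * f x + f (x - w)‖ ≤ C * w ^ (1 + a)) :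
    Integrable (𝓕 f) := by
  have hC : 0 ≤ C := by
    have := (integral_nonneg fun x => norm_nonneg (f (x + 1) - 2 * f x + f (x - 1))).trans
      (h 1 one_pos)
    simpa using this
  set B := ∫ x, ‖f x‖
  have hB : 0 ≤ B := integral_nonneg fun x => norm_nonneg _
  refine ((integrable_one_add_abs_rpow (r := -(1 + a)) (by linarith)).const_mul
    ((B + C) * 2 ^ (1 + a))).mono'
    (continuous_fourier_of_integrable hf).aestronglyMeasurable (ae_of_all _ fun t => ?_)
  have h2 : (0 : ℝ) < 2 ^ (1 + a) := by positivity
  rw [Real.rpow_neg (by positivity), ← div_eq_mul_inv, le_div_iff₀ (by positivity)]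
  rcases le_total |t| 1 with ht | ht
  · calc ‖𝓕 f t‖ * (1 + |t|) ^ (1 + a) ≤ B * 2 ^ (1 + a) := by
          gcongr
          · exact norm_fourier_le_integral_norm f t
          · linarith
      _ ≤ _ := by gcongr; linarith
  · have ht0 : t ≠ 0 := by rintro rfl; simp at ht; linarith
    have e1 := (four_mul_norm_fourier_le hf ht0).trans (h _ (by positivity))
    have e2 : ‖𝓕 f t‖ ≤ C * (|t|⁻¹) ^ (1 + a) := by
      have : C * (2 * |t|)⁻¹ ^ (1 + a) ≤ C * (|t|⁻¹) ^ (1 + a) := by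
        gcongr
        linarith
      linarith [norm_nonneg (𝓕 f t)]
    calc ‖𝓕 f t‖ * (1 + |t|) ^ (1 + a) ≤ C * (|t|⁻¹) ^ (1 + a) * (2 * |t|) ^ (1 + a) := by
          gcongr; linarith
      _ = C * (|t|⁻¹ * (2 * |t|)) ^ (1 + a) := by
          rw [mul_assoc, ← Real.mul_rpow (by positivity) (by positivity)]
      _ = C * 2 ^ (1 + a) := by
          congr 2; field_simp
      _ ≤ _ := by gcongr; linarith

theorem integrable_fourier_stretchedExp {α : ℝ} (hα : 0 < α) (b c : ℝ) :
    Integrable (𝓕 fun x : ℝ => ((stretchedExp α b c x : ℝ) : ℂ)) := by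
  -- The estimates near 0 need a ≤ α, and integrability of (1 + |x|)^{a-2} needs a < 1.
  set a := min α (1 / 2)
  have ha : 0 < a := lt_min hα (by norm_num)
  have ha1 : a ≤ 1 / 2 := min_le_right _ _
  obtain ⟨C, hC, H⟩ := exists_abs_second_difference_stretchedExp_le hα ha (min_le_left _ _)
    (by linarith) b c
  have hP := integrable_one_add_abs_rpow (r := a - 2) (by linarith)
  have hf := integrable_stretchedExp hα b c
  refine integrable_fourier_of_second_difference (a := a)
    (C := C * ∫ x : ℝ, (1 + |x|) ^ (a - 2)) hf ha fun w hw => ?_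
  calc ∫ x, ‖((stretchedExp α b c (x + w) : ℝ) : ℂ) - 2 * (stretchedExp α b c x : ℝ)
        + (stretchedExp α b c (x - w) : ℝ)‖
      ≤ ∫ x, C * (w ^ a * (1 + |x / w|) ^ (a - 2)) := by
        refine integral_mono_of_nonneg (ae_of_all _ fun x => norm_nonneg _)
          (((hP.comp_div hw.ne').const_mul _).const_mul _) (ae_of_all _ fun x => ?_)
        have := H w hw x
        rw [← Real.norm_eq_abs, ← Complex.norm_real] at this
        push_cast at this
        exact this
    _ = C * (∫ x : ℝ, (1 + |x|) ^ (a - 2)) * w ^ (1 + a) := by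
        rw [integral_const_mul, integral_const_mul,
          Measure.integral_comp_div (fun x : ℝ => (1 + |x|) ^ (a - 2)), abs_of_pos hw,
          Real.rpow_add hw, Real.rpow_one, smul_eq_mul]
        ring

/-! ### Fourier inversion and the Wiener algebra -/

theorem eq_integral_fourier {f : ℝ → ℂ} (hc : Continuous f) (hf : Integrable f)
    (hf' : Integrable (𝓕 f)) (x : ℝ) :
    f x = ∫ t : ℝ, 𝓕 f t * Complex.exp (2 * π * I * t * x) := by
  conv_lhs => rw [← hc.fourierInv_fourier_eq hf hf', Real.fourierInv_eq']
  refine integral_congr_ae (ae_of_all _ fun t => ?_)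
  simp only [smul_eq_mul]
  rw [mul_comm]
  congr 2
  simp
  ring

/-- Fourier inversion, with t replaced by -t/(2π) to pass from the kernel e^{2πitx} to e^{-itx}. -/
theorem memWienerAlgebra_of_integrable_fourier {f : ℝ → ℂ} (hc : Continuous f)
    (hf : Integrable f) (hf' : Integrable (𝓕 f)) : MemWienerAlgebra f := by
  have h2 : (-(2 * π))⁻¹ ≠ 0 := by simp [Real.pi_ne_zero]
  refine ⟨fun t => ((2 * π)⁻¹ : ℝ) * 𝓕 f ((-(2 * π))⁻¹ * t),
    (hf'.comp_mul_left' h2).const_mul _, fun x => ?_⟩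
  rw [eq_integral_fourier hc hf hf' x]
  have := Measure.integral_comp_mul_left
    (fun t : ℝ => 𝓕 f t * Complex.exp (2 * π * I * t * x)) (-(2 * π))⁻¹
  rw [inv_inv, abs_neg, abs_of_pos Real.two_pi_pos] at this
  have h3 : ∀ t : ℝ, ((2 * π)⁻¹ : ℝ) * 𝓕 f ((-(2 * π))⁻¹ * t) * Complex.exp (-(I * t * x))
      = ((2 * π)⁻¹ : ℝ) * (𝓕 f ((-(2 * π))⁻¹ * t) *
        Complex.exp (2 * π * I * ((-(2 * π))⁻¹ * t : ℝ) * x)) := by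
    intro t
    rw [mul_assoc]
    congr 3
    push_cast
    field_simp
  simp_rw [h3]
  rw [integral_const_mul, this, Complex.real_smul, ← mul_assoc, ← Complex.ofReal_mul,
    inv_mul_cancel₀ Real.two_pi_pos.ne', Complex.ofReal_one, one_mul]

/-! ### The multiplier conditions, part (a) -/

theorem hasDerivAt_stretchedExp_one_zero (α : ℝ) {x : ℝ} (hx : x ≠ 0) :
    HasDerivAt (stretchedExp α 1 0) (x⁻¹ * stretchedExp α 0 (-α) x) x := by
  have key : ∀ y : ℝ, 0 < y →
      HasDerivAt (stretchedExp α 1 0) (y⁻¹ * stretchedExp α 0 (-α) y) y := by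
    intro y hy
    refine (hasDerivAt_stretchedExp α 1 0 hy).congr_deriv ?_
    simp only [stretchedExpDeriv, stretchedExp, abs_of_pos hy]
    ring
  rcases hx.lt_or_gt with h | h
  · have h1 := (key (-x) (by linarith)).scomp x (hasDerivAt_neg x)
    have h2 : stretchedExp α 1 0 ∘ Neg.neg = stretchedExp α 1 0 :=
      funext fun y => stretchedExp_neg α 1 0 y
    rw [h2, stretchedExp_neg] at h1
    refine h1.congr_deriv ?_
    rw [smul_eq_mul, inv_neg]
    ring
  · exact key x h

/-- At x = 0 the factor x kills whatever value `deriv` takes, and the right side vanishes because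
0^α = 0. -/
theorem mul_deriv_ofReal_stretchedExp {α : ℝ} (hα : 0 < α) (x : ℝ) :
    (x : ℂ) * deriv (fun y : ℝ => ((stretchedExp α 1 0 y : ℝ) : ℂ)) x
      = (stretchedExp α 0 (-α) x : ℝ) := by
  rcases eq_or_ne x 0 with rfl | hx
  · simp [stretchedExp, Real.zero_rpow hα.ne']
  · rw [(hasDerivAt_stretchedExp_one_zero α hx).ofReal_comp.deriv]
    push_cast
    rw [mul_inv_cancel_left₀ (by exact_mod_cast hx)]

/-- At 0, where φ may fail to be differentiable, the difference quotient of xφ(x) is φ itself, so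
continuity suffices. -/
theorem hasDerivAt_mul_stretchedExp {α : ℝ} (hα : 0 < α) (x : ℝ) :
    HasDerivAt (fun y : ℝ => y * stretchedExp α 1 0 y) (stretchedExp α 1 (-α) x) x := by
  rcases eq_or_ne x 0 with rfl | hx
  · have h1 : stretchedExp α 1 (-α) 0 = stretchedExp α 1 0 0 := by
      simp [stretchedExp, Real.zero_rpow hα.ne']
    rw [h1, hasDerivAt_iff_tendsto_slope]
    refine ((continuous_stretchedExp hα 1 0).tendsto 0 |>.mono_left nhdsWithin_le_nhds).congr' ?_
    filter_upwards [self_mem_nhdsWithin] with y hy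
    have : y ≠ 0 := hy
    simp [slope, this]
  · refine ((hasDerivAt_id x).fun_mul (hasDerivAt_stretchedExp_one_zero α hx)).congr_deriv ?_
    simp only [id, one_mul]
    rw [mul_inv_cancel_left₀ hx]
    simp only [stretchedExp]
    ring

theorem integrable_mul_stretchedExp {α : ℝ} (hα : 0 < α) :
    Integrable fun x : ℝ => (x : ℂ) * (stretchedExp α 1 0 x : ℝ) := by
  obtain ⟨C, -, H⟩ := exists_abs_mul_exp_neg_abs_rpow_le hα
  have hc := continuous_stretchedExp hα 1 0
  refine ((integrable_one_add_abs_rpow (r := -2) (by norm_num)).const_mul C).mono'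
    (by fun_prop) (ae_of_all _ fun x => ?_)
  rw [← Complex.ofReal_mul, Complex.norm_real]
  simpa [stretchedExp] using H x

theorem antitoneOn_stretchedExp {α : ℝ} (hα : 0 < α) :
    AntitoneOn (stretchedExp α 1 0) (Set.Ici 0) := by
  intro x hx y hy hxy
  have hx : 0 ≤ x := hx
  simp only [stretchedExp, zero_mul, add_zero, one_mul, abs_of_nonneg hx, abs_of_nonneg (hx.trans hxy)]
  gcongr

/-- The function is bounded and monotone on each side of 0; the decreasing half is handled through
its negative. -/
theorem boundedVariationOn_stretchedExp {α : ℝ} (hα : 0 < α) (δ : ℝ) :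
    BoundedVariationOn (stretchedExp α 1 0) (Set.Icc (-δ) δ) := by
  have hb : ∀ x, |stretchedExp α 1 0 x| ≤ 1 := by
    intro x
    simp [stretchedExp]
    positivity
  rcases lt_or_ge δ 0 with hδ | hδ
  · rw [Set.Icc_eq_empty (by linarith)]
    simp [BoundedVariationOn, eVariationOn.subsingleton]
  have hm : MonotoneOn (stretchedExp α 1 0) (Set.Icc (-δ) 0) := by
    intro x hx y hy hxy
    rw [← stretchedExp_neg α 1 0 x, ← stretchedExp_neg α 1 0 y]
    exact antitoneOn_stretchedExp hα (Set.mem_Ici.2 (by linarith [hy.2]))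
      (Set.mem_Ici.2 (by linarith [hx.2])) (by linarith)
  have h1 := hm.boundedVariationOn fun x _ => hb x
  have hn : MonotoneOn (fun x => -stretchedExp α 1 0 x) (Set.Icc 0 δ) := by
    intro x hx y hy hxy
    exact neg_le_neg (antitoneOn_stretchedExp hα hx.1 hy.1 hxy)
  have h2 := hn.boundedVariationOn (C := 1) fun x _ => by simpa using hb x
  have h3 : BoundedVariationOn (stretchedExp α 1 0) (Set.Icc 0 δ) := by
    have := (LipschitzWith.id (α := ℝ)).neg.comp_boundedVariationOn h2
    simpa [Function.comp_def] using this
  rw [← Set.Icc_union_Icc_eq_Icc (b := 0) (by linarith) hδ]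
  unfold BoundedVariationOn
  rw [eVariationOn.union (x := 0) _ (isGreatest_Icc (by linarith)) (isLeast_Icc hδ)]
  exact ENNReal.add_ne_top.2 ⟨h1, h3⟩

theorem isDPointMultiplier_stretchedExp {α : ℝ} (hα : 0 < α) :
    IsDPointMultiplier fun x : ℝ => ((stretchedExp α 1 0 x : ℝ) : ℂ) where
  locally_bv := ⟨1, one_pos, (Complex.isometry_ofReal.lipschitz.comp_boundedVariationOn
    (boundedVariationOn_stretchedExp hα 1)).mono Set.Ioo_subset_Icc_self⟩
  map_zero := by simp [stretchedExp, Real.zero_rpow hα.ne']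
  integrable_mul := integrable_mul_stretchedExp hα
  mem_wiener := memWienerAlgebra_of_integrable_fourier
    (Complex.continuous_ofReal.comp (continuous_stretchedExp hα 1 0))
    (integrable_stretchedExp hα 1 0) (integrable_fourier_stretchedExp hα 1 0)
  differentiableAt x hx := (hasDerivAt_stretchedExp_one_zero α hx).ofReal_comp.differentiableAt
  mem_wiener_mul_deriv := by
    simp_rw [mul_deriv_ofReal_stretchedExp hα]
    exact memWienerAlgebra_of_integrable_fourier
      (Complex.continuous_ofReal.comp (continuous_stretchedExp hα 0 (-α)))
      (integrable_stretchedExp hα 0 (-α)) (integrable_fourier_stretchedExp hα 0 (-α))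
  integrable_mul_deriv := by
    simp_rw [mul_deriv_ofReal_stretchedExp hα]
    exact integrable_stretchedExp hα 0 (-α)

/-! ### The Fourier transform of xφ(x) -/

theorem fourier_ofReal_stretchedExp_one_neg {α : ℝ} (hα : 0 < α) (t : ℝ) :
    𝓕 (fun x : ℝ => ((stretchedExp α 1 (-α) x : ℝ) : ℂ)) t
      = 2 * π * I * t * 𝓕 (fun x : ℝ => (x : ℂ) * (stretchedExp α 1 0 x : ℝ)) t := by
  have hd : ∀ x : ℝ, HasDerivAt (fun x : ℝ => (x : ℂ) * (stretchedExp α 1 0 x : ℝ))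
      (stretchedExp α 1 (-α) x : ℝ) x := by
    intro x
    simpa using (hasDerivAt_mul_stretchedExp hα x).ofReal_comp
  have he : deriv (fun x : ℝ => (x : ℂ) * (stretchedExp α 1 0 x : ℝ))
      = fun x : ℝ => ((stretchedExp α 1 (-α) x : ℝ) : ℂ) := funext fun x => (hd x).deriv
  have := Real.fourier_deriv (integrable_mul_stretchedExp hα)
    (fun x => (hd x).differentiableAt) (by rw [he]; exact integrable_stretchedExp hα 1 (-α))
  rw [he] at this
  exact congrFun this t

/-- On [-1, 1] the transform m is continuous; outside, |m(t)| ≤ |2πt m(t)|, which is the modulus of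
the integrable transform of (xφ)'. -/
theorem integrable_fourier_mul_stretchedExp {α : ℝ} (hα : 0 < α) :
    Integrable (𝓕 fun x : ℝ => (x : ℂ) * (stretchedExp α 1 0 x : ℝ)) := by
  set m := 𝓕 fun x : ℝ => (x : ℂ) * (stretchedExp α 1 0 x : ℝ) with hm
  have hmc : Continuous m := continuous_fourier_of_integrable (integrable_mul_stretchedExp hα)
  have hχ := integrable_fourier_stretchedExp hα 1 (-α)
  have hI : IntegrableOn m (Set.Icc (-1) 1) := hmc.continuousOn.integrableOn_Icc
  have h2 := ((integrable_indicator_iff measurableSet_Icc).2 hI).norm.add hχ.norm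
  refine h2.mono' hmc.aestronglyMeasurable (ae_of_all _ fun t => ?_)
  simp only [Pi.add_apply]
  by_cases ht : t ∈ Set.Icc (-1 : ℝ) 1
  · rw [Set.indicator_of_mem ht]
    exact le_add_of_nonneg_right (norm_nonneg _)
  · rw [Set.indicator_of_notMem ht, norm_zero, zero_add, fourier_ofReal_stretchedExp_one_neg hα,
      norm_mul]
    refine le_mul_of_one_le_left (norm_nonneg _) ?_
    have h1 : 1 ≤ |t| := by
      rw [← not_lt]
      exact fun h => ht ⟨(abs_lt.1 h).1.le, (abs_lt.1 h).2.le⟩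
    simp [abs_of_pos Real.pi_pos]
    nlinarith [Real.pi_gt_three]

theorem summable_one_add_abs_mul_int_rpow {ε : ℝ} (hε : 0 < ε) :
    Summable fun k : ℤ => (1 + |ε * k|) ^ (-2 : ℝ) := by
  refine Summable.of_norm_bounded_eventually
    ((Real.summable_abs_int_rpow (b := 2) (by norm_num)).mul_left (ε ^ (-2 : ℝ))) ?_
  -- The index 0 is left out because the real power `0 ^ (-2)` is 0, so the comparison fails there.
  have : ({0} : Set ℤ)ᶜ ∈ cofinite := (Set.finite_singleton 0).compl_mem_cofinite
  filter_upwards [this] with k hk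
  have hk' : 0 < |(k : ℝ)| := abs_pos.2 (by exact_mod_cast hk)
  rw [Real.norm_of_nonneg (by positivity), ← Real.mul_rpow hε.le (abs_nonneg _)]
  refine Real.rpow_le_rpow_of_nonpos (by positivity) ?_ (by norm_num)
  rw [abs_mul, abs_of_pos hε]
  linarith

/-! ### Multiplier series of continuous periodic functions -/

section FourierSeries

variable {T : ℝ} [hT : Fact (0 < T)]

theorem norm_fourierCoeff_le (G : C(AddCircle T, ℂ)) (k : ℤ) : ‖fourierCoeff G k‖ ≤ ‖G‖ := by
  have := norm_integral_le_of_norm_le_const (μ := AddCircle.haarAddCircle (T := T))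
    (f := fun t : AddCircle T => fourier (-k) t • G t) (C := ‖G‖) (ae_of_all _ fun t => by
      rw [norm_smul, show ‖fourier (-k) t‖ = 1 from Circle.norm_coe _, one_mul]
      exact G.norm_coe_le_norm t)
  simpa [fourierCoeff] using this

/-- If `ψ(x) = ∫ m(t) e^{2πitx} dt`, then the Fourier multiplier series with multipliers `ψ(εk)` of
a continuous periodic function is given by integration against `m`. -/
theorem tsum_mul_fourierCoeff_eq_integral {ψ m : ℝ → ℂ} (hm : Integrable m)
    (hψ : ∀ x : ℝ, ψ x = ∫ t : ℝ, m t * Complex.exp (2 * π * I * t * x)) {ε : ℝ}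
    (hs : Summable fun k : ℤ => ‖ψ (ε * k)‖) (G : C(AddCircle T, ℂ)) :
    ∑' k : ℤ, ψ (ε * k) * fourierCoeff G k = ∫ t : ℝ, m t * G ((ε * T * t : ℝ) : AddCircle T) := by
  have hs' : ∀ G : C(AddCircle T, ℂ), Summable fun k : ℤ => ‖ψ (ε * k) * fourierCoeff G k‖ := by
    intro G
    refine (hs.mul_right ‖G‖).of_nonneg_of_le (fun k => norm_nonneg _) fun k => ?_
    rw [norm_mul]
    gcongr
    exact norm_fourierCoeff_le G k
  have hGi : ∀ G : C(AddCircle T, ℂ), Integrable G AddCircle.haarAddCircle := fun G =>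
    G.continuous.integrable_of_hasCompactSupport (HasCompactSupport.of_compactSpace _)
  have hcont : ∀ G : C(AddCircle T, ℂ),
      Continuous fun t : ℝ => G ((ε * T * t : ℝ) : AddCircle T) := fun G =>
    G.continuous.comp ((AddCircle.continuous_mk' T).comp (by fun_prop))
  have hi : ∀ G : C(AddCircle T, ℂ),
      Integrable fun t : ℝ => m t * G ((ε * T * t : ℝ) : AddCircle T) := fun G =>
    hm.mul_bdd (c := ‖G‖) (hcont G).aestronglyMeasurable
      (ae_of_all _ fun t => G.norm_coe_le_norm _)
  -- Both sides are bounded linear functionals of G. They agree on the characters, where the formula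
  -- is the representation of ψ(εn), and the characters span a dense subspace.
  let A : C(AddCircle T, ℂ) →L[ℂ] ℂ := LinearMap.mkContinuous
    { toFun := fun G => ∑' k : ℤ, ψ (ε * k) * fourierCoeff G k
      map_add' := fun G G' => by
        rw [← (hs' G).of_norm.tsum_add (hs' G').of_norm]
        congr 1 with k
        rw [ContinuousMap.coe_add, fourierCoeff.add (hGi G) (hGi G'), Pi.add_apply, mul_add]
      map_smul' := fun c G => by
        rw [RingHom.id_apply, smul_eq_mul, ← tsum_mul_left]
        congr 1 with k
        rw [ContinuousMap.coe_smul, fourierCoeff.const_smul, smul_eq_mul, mul_left_comm] }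
    (∑' k : ℤ, ‖ψ (ε * k)‖) fun G => by
      rw [← hs.tsum_mul_right]
      refine (norm_tsum_le_tsum_norm (hs' G)).trans
        ((hs' G).tsum_le_tsum (fun k => ?_) (hs.mul_right _))
      rw [norm_mul]
      gcongr
      exact norm_fourierCoeff_le G k
  let B : C(AddCircle T, ℂ) →L[ℂ] ℂ := LinearMap.mkContinuous
    { toFun := fun G => ∫ t : ℝ, m t * G ((ε * T * t : ℝ) : AddCircle T)
      map_add' := fun G G' => by
        rw [← integral_add (hi G) (hi G')]
        congr 1 with t
        rw [ContinuousMap.add_apply, mul_add]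
      map_smul' := fun c G => by
        rw [RingHom.id_apply, smul_eq_mul, ← integral_const_mul]
        congr 1 with t
        rw [ContinuousMap.smul_apply, smul_eq_mul, mul_left_comm] }
    (∫ t, ‖m t‖) fun G => by
      rw [← integral_mul_const]
      refine norm_integral_le_of_norm_le (hm.norm.mul_const _) (ae_of_all _ fun t => ?_)
      rw [norm_mul]
      gcongr
      exact G.norm_coe_le_norm _
  have hAB : A = B := by
    refine ContinuousLinearMap.ext_on (s := Set.range (@fourier T)) ?_ ?_
    · exact Submodule.dense_iff_topologicalClosure_eq_top.2 span_fourier_closure_eq_top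
    · rintro _ ⟨n, rfl⟩
      change ∑' k : ℤ, ψ (ε * k) * fourierCoeff (fourier n) k
        = ∫ t : ℝ, m t * fourier n ((ε * T * t : ℝ) : AddCircle T)
      rw [tsum_eq_single n, fourierCoeff_fourier, Pi.single_eq_same, mul_one, hψ]
      · congr 1 with t
        rw [fourier_coe_apply]
        congr 2
        have : (T : ℂ) ≠ 0 := by exact_mod_cast hT.out.ne'
        push_cast
        field_simp
      · intro k hk
        rw [fourierCoeff_fourier, Pi.single_eq_of_ne hk, mul_zero]
  exact congrArg (fun L => L G) hAB

end FourierSeries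

/-! ### Periodic primitives and Fourier coefficients -/

/-- Integration by parts against the primitive of a merely integrable function. -/
theorem integral_deriv_mul_primitive {a b : ℝ} (hab : a ≤ b) {g E E' : ℝ → ℂ}
    (hg : IntervalIntegrable g volume a b) (hE : ∀ u, HasDerivAt E (E' u) u)
    (hE' : Continuous E') :
    ∫ u in a..b, E' u * (∫ t in a..u, g t) = ∫ t in a..b, (E b - E t) * g t := by
  have hg' : Integrable g (volume.restrict (Set.Ioc a b)) :=
    (intervalIntegrable_iff_integrableOn_Ioc_of_le hab).1 hg
  have hEi : Integrable E' (volume.restrict (Set.Ioc a b)) :=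
    (intervalIntegrable_iff_integrableOn_Ioc_of_le hab).1 (hE'.intervalIntegrable a b)
  -- Fubini on the triangle t ≤ u replaces the product rule, since the primitive of g need not be
  -- differentiable everywhere.
  have hms : MeasurableSet {p : ℝ × ℝ | p.2 ≤ p.1} := measurableSet_le measurable_snd measurable_fst
  have hprod := (hEi.mul_prod hg').indicator hms
  have hswap := integral_integral_swap
    (f := fun u t => {p : ℝ × ℝ | p.2 ≤ p.1}.indicator (fun p => E' p.1 * g p.2) (u, t)) hprod
  rw [intervalIntegral.integral_of_le hab, intervalIntegral.integral_of_le hab]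
  calc _ = ∫ u in Set.Ioc a b, ∫ t in Set.Ioc a b,
          {p : ℝ × ℝ | p.2 ≤ p.1}.indicator (fun p => E' p.1 * g p.2) (u, t) := by
        refine setIntegral_congr_fun measurableSet_Ioc fun u hu => ?_
        have : ∀ t, {p : ℝ × ℝ | p.2 ≤ p.1}.indicator (fun p => E' p.1 * g p.2) (u, t)
            = (Set.Iic u).indicator (fun t => E' u * g t) t := fun t => rfl
        simp_rw [this]
        rw [setIntegral_indicator measurableSet_Iic, integral_const_mul,
          intervalIntegral.integral_of_le hu.1.le, Set.Ioc_inter_Iic, min_eq_right hu.2]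
    _ = ∫ t in Set.Ioc a b, ∫ u in Set.Ioc a b,
          {p : ℝ × ℝ | p.2 ≤ p.1}.indicator (fun p => E' p.1 * g p.2) (u, t) := hswap
    _ = _ := by
        refine setIntegral_congr_fun measurableSet_Ioc fun t ht => ?_
        have : ∀ u, {p : ℝ × ℝ | p.2 ≤ p.1}.indicator (fun p => E' p.1 * g p.2) (u, t)
            = (Set.Ici t).indicator (fun u => E' u * g t) u := fun u => rfl
        simp_rw [this]
        have hset : Set.Ioc a b ∩ Set.Ici t = Set.Icc t b := by
          ext u
          simp only [Set.mem_inter_iff, Set.mem_Ioc, Set.mem_Ici, Set.mem_Icc]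
          have := ht.1
          constructor
          · rintro ⟨⟨h1, h2⟩, h3⟩; exact ⟨h3, h2⟩
          · rintro ⟨h1, h2⟩; exact ⟨⟨by linarith, h2⟩, h1⟩
        rw [setIntegral_indicator measurableSet_Ici, hset, integral_mul_const,
          integral_Icc_eq_integral_Ioc, ← intervalIntegral.integral_of_le ht.2,
          intervalIntegral.integral_eq_sub_of_hasDerivAt (fun u _ => hE u)
            (hE'.intervalIntegrable t b)]

instance fact_two_pi_pos : Fact (0 < 2 * π) := ⟨Real.two_pi_pos⟩

theorem exp_neg_int_mul_two_pi (k : ℤ) : Complex.exp (-(I * k * (2 * π : ℝ))) = 1 := by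
  rw [Complex.exp_eq_one_iff]
  exact ⟨-k, by push_cast; ring⟩

/-- A mean-zero periodic integrable function `g` has a continuous periodic primitive, whose Fourier
coefficients times `ik` are those of `g`. -/
theorem exists_periodic_primitive {g : ℝ → ℂ} (hper : Function.Periodic g (2 * π))
    (hg : ∀ a b, IntervalIntegrable g volume a b) (h0 : ∫ y in 0..(2 * π), g y = 0) :
    ∃ G : C(AddCircle (2 * π), ℂ), (∀ y : ℝ, G (y : AddCircle (2 * π)) = ∫ t in 0..y, g t) ∧
      ∀ k : ℤ, I * k * fourierCoeff G k
        = (2 * π : ℂ)⁻¹ * ∫ y in 0..(2 * π), Complex.exp (-(I * k * y)) * g y := by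
  have hH : Function.Periodic (fun y : ℝ => ∫ t in 0..y, g t) (2 * π) := by
    intro y
    change ∫ t in 0..(y + 2 * π), g t = ∫ t in 0..y, g t
    rw [← intervalIntegral.integral_add_adjacent_intervals (hg 0 y) (hg y _),
      hper.intervalIntegral_add_eq y 0, zero_add, h0, add_zero]
  have hc : Continuous (fun y : ℝ => ∫ t in 0..y, g t) :=
    intervalIntegral.continuous_primitive hg 0
  let G : C(AddCircle (2 * π), ℂ) := ⟨hH.lift, continuous_coinduced_dom.2 hc⟩
  have hG : ∀ y : ℝ, G (y : AddCircle (2 * π)) = ∫ t in 0..y, g t := fun y => rfl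
  refine ⟨G, hG, fun k => ?_⟩
  have hE : ∀ u : ℝ, HasDerivAt (fun u : ℝ => Complex.exp (-(I * k * u)))
      (-(I * k) * Complex.exp (-(I * k * u))) u := by
    intro u
    have h1 : HasDerivAt (fun u : ℝ => -(I * k * (u : ℂ))) (-(I * k)) u := by
      simpa using ((hasDerivAt_id u).ofReal_comp.const_mul (I * (k : ℂ))).fun_neg
    refine h1.cexp.congr_deriv ?_
    ring
  have hE' : Continuous fun u : ℝ => -(I * k) * Complex.exp (-(I * k * u)) := by fun_prop
  have key := integral_deriv_mul_primitive Real.two_pi_pos.le (hg 0 (2 * π)) hE hE'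
  have hEg : IntervalIntegrable (fun y : ℝ => Complex.exp (-(I * k * y)) * g y) volume 0 (2 * π) :=
    (hg 0 (2 * π)).continuousOn_mul (by fun_prop)
  -- The boundary term is a constant times the integral of g over a period, hence zero.
  simp_rw [sub_mul] at key
  rw [intervalIntegral.integral_sub ((hg _ _).const_mul _) hEg, intervalIntegral.integral_const_mul,
    h0, mul_zero, zero_sub] at key
  simp_rw [mul_assoc (-(I * (k : ℂ)))] at key
  rw [intervalIntegral.integral_const_mul, neg_mul, neg_inj] at key
  rw [← key, fourierCoeff_eq_intervalIntegral _ k 0, zero_add, Complex.real_smul,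
    mul_left_comm]
  congr 1
  · push_cast; simp
  · congr 1
    refine intervalIntegral.integral_congr fun y _ => ?_
    simp only [hG, fourier_coe_apply, smul_eq_mul]
    congr 2
    have : (π : ℂ) ≠ 0 := by exact_mod_cast Real.pi_ne_zero
    push_cast
    field_simp

/-- The substitution t = x + y absorbs e^{ikx} and moves the point of summation to 0. -/
theorem multiplierTerm_eq {f : ℝ → ℂ} (hper : Function.Periodic f (2 * π)) (c : ℤ → ℂ) (x : ℝ)
    (k : ℤ) : multiplierTerm c f x k
      = c k * ((2 * π : ℂ)⁻¹ * ∫ y in 0..(2 * π), Complex.exp (-(I * k * y)) * f (x + y)) := by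
  have hp : Function.Periodic (fun t : ℝ => Complex.exp (-(I * k * ((t - x : ℝ) : ℂ))) * f t)
      (2 * π) := by
    intro t
    simp only [hper t]
    congr 1
    rw [show -(I * k * ((t + 2 * π - x : ℝ) : ℂ))
      = -(I * k * ((t - x : ℝ) : ℂ)) + -(I * k * (2 * π : ℝ)) by push_cast; ring,
      Complex.exp_add, exp_neg_int_mul_two_pi, mul_one]
  have h1 : ∫ y in 0..(2 * π), Complex.exp (-(I * k * y)) * f (x + y)
      = ∫ t in (-π)..π, Complex.exp (-(I * k * ((t - x : ℝ) : ℂ))) * f t := by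
    have e := intervalIntegral.integral_comp_add_left (a := 0) (b := 2 * π)
      (fun t : ℝ => Complex.exp (-(I * k * ((t - x : ℝ) : ℂ))) * f t) x
    simp only [add_sub_cancel_left, add_zero] at e
    rw [e, hp.intervalIntegral_add_eq x (-π)]
    congr 1
    ring
  rw [h1, multiplierTerm, fourierCoeffOn_eq_integral, Complex.real_smul, mul_assoc, mul_assoc]
  congr 2
  · push_cast; simp; ring
  · rw [← intervalIntegral.integral_mul_const]
    refine intervalIntegral.integral_congr fun y _ => ?_
    simp only [fourier_coe_apply, smul_eq_mul]
    rw [mul_right_comm, ← Complex.exp_add]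
    congr 2
    have : (π : ℂ) ≠ 0 := by exact_mod_cast Real.pi_ne_zero
    push_cast
    field_simp
    ring

theorem summable_multiplierTerm {f : ℝ → ℂ} (hper : Function.Periodic f (2 * π))
    {c : ℤ → ℂ} (hc : Summable fun k => ‖c k‖) (x : ℝ) : Summable (multiplierTerm c f x) := by
  refine (hc.mul_right ‖(2 * π : ℂ)⁻¹‖ |>.mul_right (∫ y in 0..(2 * π), ‖f (x + y)‖)).of_norm_bounded
    fun k => ?_
  rw [multiplierTerm_eq hper, norm_mul, norm_mul, ← mul_assoc]
  gcongr
  refine (intervalIntegral.norm_integral_le_integral_norm Real.two_pi_pos.le).trans_eq ?_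
  refine intervalIntegral.integral_congr fun y _ => ?_
  simp only [norm_mul]
  rw [show -(I * k * (y : ℂ)) = ((-(k * y) : ℝ) : ℂ) * I by push_cast; ring,
    Complex.norm_exp_ofReal_mul_I, one_mul]

/-! ### Summation at a d-point, part (b) -/

/-- The difference quotients at `0` of a bounded function differentiable at `0` and vanishing there
are bounded. -/
theorem exists_norm_div_le_of_hasDerivAt_zero {H : ℝ → ℂ} {d : ℂ} (hd : HasDerivAt H d 0)
    (h0 : H 0 = 0) {B : ℝ} (hB : ∀ y, ‖H y‖ ≤ B) : ∃ K : ℝ, ∀ y : ℝ, ‖H y / y‖ ≤ K := by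
  have hB0 : 0 ≤ B := (norm_nonneg _).trans (hB 0)
  have ht : Tendsto (fun y : ℝ => ‖H y / y‖) (𝓝[≠] 0) (𝓝 ‖d‖) := by
    refine (hasDerivAt_iff_tendsto_slope.1 hd).norm.congr fun y => ?_
    simp [slope, h0, div_eq_inv_mul]
  have he := ht.eventually (ge_mem_nhds (lt_add_one ‖d‖))
  rw [eventually_nhdsWithin_iff, Metric.eventually_nhds_iff] at he
  obtain ⟨δ, hδ, H1⟩ := he
  refine ⟨‖d‖ + 1 + B / δ, fun y => ?_⟩
  rcases eq_or_ne y 0 with rfl | hy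
  · simp; positivity
  · rcases lt_or_ge (dist y 0) δ with h | h
    · exact (H1 h hy).trans (le_add_of_nonneg_right (by positivity))
    · rw [dist_zero_right] at h
      rw [norm_div, Complex.norm_real]
      exact (div_le_div₀ hB0 (hB y) hδ h).trans (le_add_of_nonneg_left (by positivity))

/-- A summation method whose multiplier `φ` has `φ(0) = 1` and for which `xφ(x)` is the Fourier
transform of `m`, with `m` and `t m(t)` in `L₁`, sums the Fourier series of an integrable function
at each of its `d`-points. -/
theorem tendsto_tsum_multiplierTerm {φ m : ℝ → ℂ} (hφ0 : φ 0 = 1) (hm : Integrable m)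
    (hψ : ∀ x : ℝ, (x : ℂ) * φ x = ∫ t : ℝ, m t * Complex.exp (2 * π * I * t * x))
    (hχ : Integrable fun t : ℝ => 2 * π * I * t * m t)
    (hχ1 : ∫ t : ℝ, 2 * π * I * t * m t = 1)
    (hs : ∀ ε : ℝ, 0 < ε → Summable fun k : ℤ => ‖((ε * k : ℝ) : ℂ) * φ (ε * k)‖)
    {f : ℝ → ℂ} (hper : Function.Periodic f (2 * π))
    (hf : IntervalIntegrable f volume (-π) π) {x : ℝ} {d : ℂ} (hd : IsDPoint f x d) :
    Tendsto (fun ε : ℝ => ∑' k : ℤ, multiplierTerm (fun k : ℤ => φ (ε * (k : ℝ))) f x k)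
      (𝓝[>] 0) (𝓝 d) := by
  have hfi : ∀ a b, IntervalIntegrable f volume a b :=
    hper.intervalIntegrable Real.two_pi_pos.ne' (t := -π) (by convert hf using 1; ring)
  have hfx : ∀ a b, IntervalIntegrable (fun y => f (x + y)) volume a b := fun a b => by
    have := (hfi (x + a) (x + b)).comp_add_left x
    simpa using this
  -- Removing the mean c makes the primitive periodic; c comes back as the term k = 0, because φ(0)
  -- = 1.
  set c : ℂ := (2 * π : ℂ)⁻¹ * ∫ y in 0..(2 * π), f (x + y) with hc
  have hpi : (2 * π : ℂ) ≠ 0 := by exact_mod_cast Real.two_pi_pos.ne'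
  have hgp : Function.Periodic (fun y => f (x + y) - c) (2 * π) := fun y => by
    simp only [← add_assoc, hper (x + y)]
  have hgi : ∀ a b, IntervalIntegrable (fun y => f (x + y) - c) volume a b := fun a b =>
    (hfx a b).sub intervalIntegrable_const
  have hg0 : ∫ y in 0..(2 * π), (f (x + y) - c) = 0 := by
    rw [intervalIntegral.integral_sub (hfx _ _) intervalIntegrable_const,
      intervalIntegral.integral_const, sub_zero, Complex.real_smul, hc]
    push_cast
    rw [mul_inv_cancel_left₀ hpi, sub_self]
  obtain ⟨G, hG, hGk⟩ := exists_periodic_primitive hgp hgi hg0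
  have hterm : ∀ (ε : ℝ), 0 < ε → ∀ k : ℤ, multiplierTerm (fun k : ℤ => φ (ε * (k : ℝ))) f x k
      = (if k = 0 then c else 0) + I / ε * (((ε * k : ℝ) : ℂ) * φ (ε * k) * fourierCoeff G k) := by
    intro ε hε k
    have hε' : (ε : ℂ) ≠ 0 := by exact_mod_cast hε.ne'
    rw [multiplierTerm_eq hper]
    split_ifs with hk
    · subst hk
      simp [hφ0, hc]
    · have hk' : (k : ℂ) ≠ 0 := by exact_mod_cast hk
      have e1 : ∫ y in 0..(2 * π), Complex.exp (-(I * k * y)) = 0 := by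
        have := integral_exp_mul_complex (a := 0) (b := 2 * π) (c := -(I * k))
          (neg_ne_zero.2 (mul_ne_zero I_ne_zero hk'))
        simp_rw [neg_mul] at this
        rw [this, exp_neg_int_mul_two_pi]
        simp
      have hei : IntervalIntegrable (fun y : ℝ => Complex.exp (-(I * k * y))) volume 0 (2 * π) :=
        Continuous.intervalIntegrable (by fun_prop) _ _
      have e2 := hGk k
      simp_rw [mul_sub] at e2
      rw [intervalIntegral.integral_sub ((hfx _ _).continuousOn_mul (by fun_prop))
        (hei.mul_const c), intervalIntegral.integral_mul_const, e1, zero_mul, sub_zero] at e2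
      rw [← e2]
      push_cast
      field_simp
      ring
  have hsum : ∀ ε : ℝ, 0 < ε →
      ∑' k : ℤ, multiplierTerm (fun k : ℤ => φ (ε * (k : ℝ))) f x k
        = c + ∫ t : ℝ, 2 * π * I * t * m t *
          (G ((ε * (2 * π) * t : ℝ) : AddCircle (2 * π)) / ((ε * (2 * π) * t : ℝ) : ℂ)) := by
    intro ε hε
    have hε' : (ε : ℂ) ≠ 0 := by exact_mod_cast hε.ne'
    have hsG : Summable fun k : ℤ => ((ε * k : ℝ) : ℂ) * φ (ε * k) * fourierCoeff G k := by
      refine ((hs ε hε).mul_right ‖G‖).of_norm_bounded fun k => ?_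
      rw [norm_mul]
      gcongr
      exact norm_fourierCoeff_le G k
    rw [tsum_congr (hterm ε hε), (hasSum_ite_eq (0 : ℤ) c).summable.tsum_add (hsG.mul_left _),
      tsum_ite_eq, tsum_mul_left,
      tsum_mul_fourierCoeff_eq_integral (ψ := fun x : ℝ => (x : ℂ) * φ x) hm hψ (hs ε hε) G,
      ← integral_const_mul]
    congr 2 with t
    -- At t = 0 the quotient is 0/0, but both integrands vanish there since G(0) = 0.
    rcases eq_or_ne t 0 with rfl | ht
    · have := hG 0
      rw [intervalIntegral.integral_same] at this
      simp only [mul_zero, this, zero_div]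
    · have ht' : (t : ℂ) ≠ 0 := by exact_mod_cast ht
      have : (π : ℂ) ≠ 0 := by exact_mod_cast Real.pi_ne_zero
      push_cast
      field_simp
  have hH0 : G ((0 : ℝ) : AddCircle (2 * π)) = 0 := by
    rw [hG, intervalIntegral.integral_same]
  -- Here G(y) = F(x + y) - F(x) - cy, and the d-point hypothesis differentiates F at x.
  have hHd : HasDerivAt (fun y : ℝ => G (y : AddCircle (2 * π))) (d - c) 0 := by
    have h1 : HasDerivAt (fun y : ℝ => ∫ t in 0..(x + y), f t) d 0 := by
      have : HasDerivAt (fun y : ℝ => ∫ t in 0..y, f t) d (x + 0) := by rw [add_zero]; exact hd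
      exact this.comp_const_add x 0
    have h2 : HasDerivAt (fun y : ℝ => (y : ℂ) * c) c 0 := by
      simpa using (hasDerivAt_id (0 : ℝ)).ofReal_comp.mul_const c
    have h3 := (h1.sub_const (∫ t in 0..x, f t)).sub h2
    refine h3.congr_of_eventuallyEq (Eventually.of_forall fun y => ?_)
    simp only [Pi.sub_apply]
    rw [hG, intervalIntegral.integral_sub (hfx _ _) intervalIntegrable_const,
      intervalIntegral.integral_const, sub_zero, Complex.real_smul,
      intervalIntegral.integral_interval_sub_left (hfi _ _) (hfi _ _),
      intervalIntegral.integral_comp_add_left, add_zero]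
  obtain ⟨K, hK⟩ := exists_norm_div_le_of_hasDerivAt_zero hHd hH0
    (B := ‖G‖) (fun y => G.norm_coe_le_norm _)
  have hlim : Tendsto (fun ε : ℝ => ∫ t : ℝ, 2 * π * I * t * m t *
      (G ((ε * (2 * π) * t : ℝ) : AddCircle (2 * π)) / ((ε * (2 * π) * t : ℝ) : ℂ)))
      (𝓝[>] 0) (𝓝 (∫ t : ℝ, 2 * π * I * t * m t * (d - c))) := by
    refine tendsto_integral_filter_of_dominated_convergence
      (fun t => ‖2 * π * I * t * m t‖ * K) (Eventually.of_forall fun ε => ?_)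
      (Eventually.of_forall fun ε => ae_of_all _ fun t => ?_) (hχ.norm.mul_const K) ?_
    · refine hχ.aestronglyMeasurable.mul (Measurable.aestronglyMeasurable ?_)
      have : Continuous fun t : ℝ => G ((ε * (2 * π) * t : ℝ) : AddCircle (2 * π)) :=
        G.continuous.comp ((AddCircle.continuous_mk' _).comp (by fun_prop))
      exact this.measurable.div (by fun_prop)
    · rw [norm_mul]
      gcongr
      exact hK _
    · have hae : ∀ᵐ t : ℝ, t ≠ 0 := Measure.ae_ne volume 0
      filter_upwards [hae] with t ht
      refine Tendsto.const_mul _ ?_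
      have h1 : Tendsto (fun y : ℝ => G (y : AddCircle (2 * π)) / (y : ℂ)) (𝓝[≠] 0) (𝓝 (d - c)) := by
        refine (hasDerivAt_iff_tendsto_slope.1 hHd).congr fun y => ?_
        simp only [slope, vsub_eq_sub, sub_zero, hH0, Complex.real_smul, div_eq_inv_mul]
        push_cast
        rfl
      refine h1.comp (tendsto_nhdsWithin_iff.2 ⟨?_, ?_⟩)
      · have : Continuous fun ε : ℝ => ε * (2 * π) * t := by fun_prop
        simpa using (this.tendsto 0).mono_left nhdsWithin_le_nhds
      · filter_upwards [self_mem_nhdsWithin] with ε hε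
        have : ε ≠ 0 := (Set.mem_Ioi.1 hε).ne'
        simp [this, ht, Real.pi_ne_zero]
  rw [integral_mul_const, hχ1, one_mul] at hlim
  have := hlim.const_add c
  rw [add_sub_cancel] at this
  refine this.congr' ?_
  filter_upwards [self_mem_nhdsWithin] with ε hε
  exact (hsum ε hε).symm

theorem mainTheorem9 (α : ℝ) (hα : 0 < α) (φ : ℝ → ℂ)
    (hφ : ∀ x : ℝ, φ x = ((Real.exp (-(|x| ^ α)) : ℝ) : ℂ)) :
    IsDPointMultiplier φ ∧
    ∀ f : ℝ → ℂ, Function.Periodic f (2 * Real.pi) →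
      IntervalIntegrable f volume (-Real.pi) Real.pi →
      ∀ (x : ℝ) (d : ℂ), IsDPoint f x d →
        ((∀ n : ℕ, Summable (multiplierTerm (fun k : ℤ => φ ((k : ℝ) / ((n : ℝ) + 1))) f x)) ∧
          Tendsto
            (fun n : ℕ => ∑' k : ℤ, multiplierTerm (fun k : ℤ => φ ((k : ℝ) / ((n : ℝ) + 1))) f x k)
            atTop (𝓝 d)) ∧
        ((∀ ε : ℝ, 0 < ε → Summable (multiplierTerm (fun k : ℤ => φ (ε * (k : ℝ))) f x)) ∧
          Tendsto
            (fun ε : ℝ => ∑' k : ℤ, multiplierTerm (fun k : ℤ => φ (ε * (k : ℝ))) f x k)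
            (𝓝[>] 0) (𝓝 d)) := by
  obtain rfl : φ = fun x : ℝ => ((stretchedExp α 1 0 x : ℝ) : ℂ) := by
    funext x
    simp [hφ, stretchedExp]
  refine ⟨isDPointMultiplier_stretchedExp hα, fun f hper hf x d hd => ?_⟩
  set φ : ℝ → ℂ := fun x : ℝ => ((stretchedExp α 1 0 x : ℝ) : ℂ)
  have hs : ∀ ε : ℝ, 0 < ε → Summable (multiplierTerm (fun k : ℤ => φ (ε * (k : ℝ))) f x) := by
    intro ε hε
    obtain ⟨C, -, H⟩ := exists_abs_stretchedExp_le hα 1 0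
    refine summable_multiplierTerm hper (((summable_one_add_abs_mul_int_rpow hε).mul_left C).of_nonneg_of_le
      (fun k => norm_nonneg _) fun k => ?_) x
    rw [Complex.norm_real]
    exact H _
  have hs' : ∀ ε : ℝ, 0 < ε → Summable fun k : ℤ => ‖((ε * k : ℝ) : ℂ) * φ (ε * k)‖ := by
    intro ε hε
    obtain ⟨C, -, H⟩ := exists_abs_mul_exp_neg_abs_rpow_le hα
    refine ((summable_one_add_abs_mul_int_rpow hε).mul_left C).of_nonneg_of_le
      (fun k => norm_nonneg _) fun k => ?_
    rw [← Complex.ofReal_mul, Complex.norm_real]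
    simpa [stretchedExp] using H (ε * k)
  have hψc : Continuous fun x : ℝ => (x : ℂ) * (stretchedExp α 1 0 x : ℝ) := by
    have := continuous_stretchedExp hα 1 0
    fun_prop
  have hχ := integrable_fourier_stretchedExp hα 1 (-α)
  -- Inversion at 0 gives the normalisation: the transform of (xφ)' has integral (xφ)'(0) = 1.
  have hχ1 := eq_integral_fourier
    (Complex.continuous_ofReal.comp (continuous_stretchedExp hα 1 (-α)))
    (integrable_stretchedExp hα 1 (-α)) hχ 0
  simp only [Function.comp_apply, Complex.ofReal_zero, mul_zero, Complex.exp_zero, mul_one] at hχ1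
  have heq : (𝓕 fun x : ℝ => ((stretchedExp α 1 (-α) x : ℝ) : ℂ)) = _ :=
    funext (fourier_ofReal_stretchedExp_one_neg hα)
  have hT := tendsto_tsum_multiplierTerm (φ := φ)
    (m := 𝓕 fun x : ℝ => (x : ℂ) * (stretchedExp α 1 0 x : ℝ))
    (isDPointMultiplier_stretchedExp hα).map_zero (integrable_fourier_mul_stretchedExp hα)
    (eq_integral_fourier hψc (integrable_mul_stretchedExp hα)
      (integrable_fourier_mul_stretchedExp hα))
    (heq ▸ hχ)
    (by
      rw [← integral_congr_ae (ae_of_all _ (fourier_ofReal_stretchedExp_one_neg hα))]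
      refine hχ1.symm.trans ?_
      simp [stretchedExp, Real.zero_rpow hα.ne'])
    hs' hper hf hd
  -- The discrete limit is the continuous one along ε = 1/(n + 1).
  have hdiv : ∀ n : ℕ, (fun k : ℤ => φ ((k : ℝ) / ((n : ℝ) + 1)))
      = fun k : ℤ => φ (1 / ((n : ℝ) + 1) * k) := by
    intro n
    funext k
    rw [one_div_mul_eq_div]
  refine ⟨⟨fun n => ?_, ?_⟩, hs, hT⟩
  · rw [hdiv]
    exact hs _ (by positivity)
  · simp_rw [hdiv]
    exact hT.comp (tendsto_nhdsWithin_iff.2 ⟨tendsto_one_div_add_atTop_nhds_zero_nat,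
      Eventually.of_forall fun n => Set.mem_Ioi.2 (by positivity)⟩)
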